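/- Let $a,b,c\in\mathbb{Z}$ be such that $E: y^2=x^3+ax^2+bx+c$ is non-singular, i.e. its discriminant $\Delta(E)=-64a^3c+16a^2b^2+288abc-64b^3-432c^2$ is nonzero, and let $P\in E(\mathbb{Q})$ be a point of infinite order. For $k\ge 0$ write $2^kP=\left(\frac{m_k}{e_k^2},\frac{n_k}{e_k^3}\right)$ with $m_k,n_k,e_k\in\mathbb{Z}$, $e_k\ge 1$ and $\gcd(m_k,e_k)=\gcd(n_k,e_k)=1$, and define the elliptic Fermat numbers $F_0=e_0$ and $F_k=e_k/e_{k-1}$ for $k\ge 1$; these are positive integers. For a positive integer $N$ with $\gcd(N,6\Delta(E))=1$ let $E(\mathbb{Z}/N\mathbb{Z})$ be the group of points $(x:y:z)$, with $x,y,z$ generating the unit ideal of $\mathbb{Z}/N\mathbb{Z}$ and taken up to multiplication by units, such that $y^2z=x^3+ax^2z+bxz^2+cz^3$, where $S+T$ is the point given by the primitive linear combinations of the three triples obtained by evaluating at $S,T$ the three bidegree-$(2,2)$ addition laws of the curve (Lenstra, Lange--Ruppert), and the neutral element is $(0:1:0)$. The order of $P$ in $E(\mathbb{Z}/N\mathbb{Z})$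 means the order of the reduction $(m_0e_0 \bmod N: n_0 \bmod N: e_0^3 \bmod N)$. Theorem. Let $N$ be a positive integer with $\gcd(N,6\Delta(E))=1$ and let $k\ge 0$ be an integer, with $(N,k)\neq(1,0)$. Then $F_0F_1\cdots F_k=e_k$, and $P$ has order $2^k$ in $E(\mathbb{Z}/N\mathbb{Z})$ if and only if $N\mid F_0\cdots F_k$ and $N\nmid F_0\cdots F_{k-1}$ (for $k=0$ the product $F_0\cdots F_{k-1}$ is empty and equals $1$). -/

import Mathlib

namespace EllipticFermat

/-- The cubic curve `y² = x³ + a x² + b x + c` over a commutative ring. -/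
def curve {R : Type*} [CommRing R] (a b c : R) : WeierstrassCurve R where
  a₁ := 0
  a₂ := a
  a₃ := 0
  a₄ := b
  a₆ := c

/-- The discriminant is `16` times the discriminant of the cubic `x³ + a x² + b x + c`. -/
theorem curve_disc {R : Type*} [CommRing R] (a b c : R) :
    (curve a b c).Δ =
      -64 * a ^ 3 * c + 16 * a ^ 2 * b ^ 2 + 288 * a * b * c - 64 * b ^ 3 - 432 * c ^ 2 := by
  simp only [curve, WeierstrassCurve.Δ, WeierstrassCurve.b₂, WeierstrassCurve.b₄,
    WeierstrassCurve.b₆, WeierstrassCurve.b₈]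
  ring

/-! ### Rational points in lowest terms -/

/-- `E(ℚ)` for `E : y² = x³ + a x² + b x + c`, with Mathlib's chord-and-tangent group law. -/
abbrev RatPoint (a b c : ℤ) : Type :=
  (curve (a : ℚ) (b : ℚ) (c : ℚ)).toAffine.Point

section LowestTerms

variable {a b c : ℤ}

/-- The integer `e ≥ 1` of `P = (m / e², n / e³)` in lowest terms; `e = 0` for the point at
infinity, which is `(me : n : e³) = (0 : 1 : 0)`. -/
def coordE : RatPoint a b c → ℕ
  | .zero => 0
  | .some x _ _ => Nat.sqrt x.den

/-- The integer `m` of `P = (m / e², n / e³)` in lowest terms (`1` at infinity). -/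
def coordM : RatPoint a b c → ℤ
  | .zero => 1
  | .some x _ _ => x.num

/-- The integer `n` of `P = (m / e², n / e³)` in lowest terms (`1` at infinity). -/
def coordN : RatPoint a b c → ℤ
  | .zero => 1
  | .some _ y _ => y.num

theorem equation_iff (x y : ℚ) :
    (curve (a : ℚ) (b : ℚ) (c : ℚ)).toAffine.Equation x y ↔
      y ^ 2 = x ^ 3 + a * x ^ 2 + b * x + c := by
  rw [WeierstrassCurve.Affine.equation_iff]
  simp [curve]

theorem den_sq_eq_den_cube {x y : ℚ} (h : y ^ 2 = x ^ 3 + a * x ^ 2 + b * x + c) :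
    y.den ^ 2 = x.den ^ 3 := by
  have hx : (x.den : ℚ) ≠ 0 := by exact_mod_cast x.den_ne_zero
  have hy : (y.den : ℚ) ≠ 0 := by exact_mod_cast y.den_ne_zero
  have key : y.num ^ 2 * (x.den : ℤ) ^ 3 = (y.den : ℤ) ^ 2 *
      (x.num ^ 3 + x.den * (a * x.num ^ 2 + b * x.num * x.den + c * (x.den : ℤ) ^ 2)) := by
    have h' : (y.num / y.den : ℚ) ^ 2 = (x.num / x.den : ℚ) ^ 3 + a * (x.num / x.den : ℚ) ^ 2 +
        b * (x.num / x.den : ℚ) + c := by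
      rw [Rat.num_div_den, Rat.num_div_den]; exact h
    field_simp at h'
    have h2 : (y.num : ℚ) ^ 2 * (x.den : ℚ) ^ 3 = (y.den : ℚ) ^ 2 *
      (x.num ^ 3 + x.den * (a * x.num ^ 2 + b * x.num * x.den + c * (x.den : ℚ) ^ 2)) := by
      linear_combination h'
    exact_mod_cast h2
  have cx : IsCoprime x.num (x.den : ℤ) := Int.isCoprime_iff_nat_coprime.2 x.reduced
  have cy : IsCoprime y.num (y.den : ℤ) := Int.isCoprime_iff_nat_coprime.2 y.reduced
  have d1 : (y.den : ℤ) ^ 2 ∣ (x.den : ℤ) ^ 3 :=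
    (cy.symm.pow (m := 2) (n := 2)).dvd_of_dvd_mul_left ⟨_, key⟩
  have d2 : (x.den : ℤ) ^ 3 ∣ (y.den : ℤ) ^ 2 := by
    have : IsCoprime ((x.den : ℤ) ^ 3)
        (x.num ^ 3 + x.den * (a * x.num ^ 2 + b * x.num * x.den + c * (x.den : ℤ) ^ 2)) :=
      ((cx.pow_left (m := 3)).add_mul_left_left _).symm.pow_left
    exact this.dvd_of_dvd_mul_right ⟨y.num ^ 2, by rw [← key]; ring⟩
  exact Nat.dvd_antisymm (by exact_mod_cast d1) (by exact_mod_cast d2)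

theorem den_eq {x y : ℚ} (h : y ^ 2 = x ^ 3 + a * x ^ 2 + b * x + c) :
    x.den = Nat.sqrt x.den ^ 2 ∧ y.den = Nat.sqrt x.den ^ 3 := by
  have hd := den_sq_eq_den_cube h
  have hdvd : x.den ∣ y.den :=
    (Nat.pow_dvd_pow_iff two_ne_zero).1 ⟨x.den, by rw [hd]; ring⟩
  obtain ⟨t, ht⟩ := hdvd
  have hpos := x.den_pos
  have h1 : x.den = t ^ 2 := by
    rw [ht] at hd
    have : x.den ^ 2 * t ^ 2 = x.den ^ 2 * x.den := by rw [← mul_pow, hd]; ring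
    exact (Nat.eq_of_mul_eq_mul_left (by positivity) this).symm
  have h2 : Nat.sqrt x.den = t := by rw [h1, Nat.sqrt_eq']
  rw [h2]
  exact ⟨h1, by rw [ht, h1]; ring⟩

/-- An affine rational point is `(m / e², n / e³)`. -/
theorem some_eq (x y : ℚ) (h : (curve (a : ℚ) (b : ℚ) (c : ℚ)).toAffine.Nonsingular x y) :
    let P : RatPoint a b c := .some x y h
    0 < coordE P ∧ x = coordM P / (coordE P : ℚ) ^ 2 ∧ y = coordN P / (coordE P : ℚ) ^ 3 := by
  obtain ⟨h1, h2⟩ := den_eq ((equation_iff x y).1 h.1)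
  simp only [coordE, coordM, coordN]
  refine ⟨Nat.sqrt_pos.2 x.den_pos, ?_, ?_⟩
  · conv_lhs => rw [← Rat.num_div_den x, h1]
    push_cast; rfl
  · conv_lhs => rw [← Rat.num_div_den y, h2]
    push_cast; rfl

theorem coprime_M (P : RatPoint a b c) : IsCoprime (coordM P) (coordE P : ℤ) := by
  rcases P with _ | ⟨x, y, h⟩
  · exact isCoprime_one_left
  · have h1 := (den_eq ((equation_iff x y).1 h.1)).1
    have : IsCoprime x.num (x.den : ℤ) := Int.isCoprime_iff_nat_coprime.2 x.reduced
    rw [h1] at this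
    push_cast at this
    exact (IsCoprime.pow_right_iff two_pos).1 this

theorem coprime_N (P : RatPoint a b c) : IsCoprime (coordN P) (coordE P : ℤ) := by
  rcases P with _ | ⟨x, y, h⟩
  · exact isCoprime_one_left
  · have h1 := (den_eq ((equation_iff x y).1 h.1)).2
    have : IsCoprime y.num (y.den : ℤ) := Int.isCoprime_iff_nat_coprime.2 y.reduced
    rw [h1] at this
    push_cast at this
    exact (IsCoprime.pow_right_iff three_pos).1 this

theorem coord_equation (P : RatPoint a b c) :
    coordN P ^ 2 = coordM P ^ 3 + a * coordM P ^ 2 * (coordE P : ℤ) ^ 2 +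
      b * coordM P * (coordE P : ℤ) ^ 4 + c * (coordE P : ℤ) ^ 6 := by
  rcases P with _ | ⟨x, y, h⟩
  · simp [coordE, coordM, coordN]
  · obtain ⟨he, hx, hy⟩ := some_eq x y h
    have heq := (equation_iff x y).1 h.1
    generalize coordE (WeierstrassCurve.Affine.Point.some x y h : RatPoint a b c) = e at *
    generalize coordM (WeierstrassCurve.Affine.Point.some x y h : RatPoint a b c) = m at *
    generalize coordN (WeierstrassCurve.Affine.Point.some x y h : RatPoint a b c) = n at *
    have he' : (e : ℚ) ≠ 0 := by exact_mod_cast he.ne'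
    rw [hx, hy] at heq
    field_simp at heq
    have h2 : (n : ℚ) ^ 2 = m ^ 3 + a * m ^ 2 * e ^ 2 + b * m * e ^ 4 + c * e ^ 6 := by
      linear_combination heq
    exact_mod_cast h2

theorem coordE_dvd_two_nsmul (P : RatPoint a b c) : coordE P ∣ coordE (2 • P) := by
  rcases P with _ | ⟨x, y, h⟩
  · have : (2 : ℕ) • (WeierstrassCurve.Affine.Point.zero : RatPoint a b c) = .zero :=
      smul_zero (M := ℕ) (A := RatPoint a b c) 2
    rw [this]
  · rw [two_nsmul]
    by_cases hy : y = (curve (a : ℚ) (b : ℚ) (c : ℚ)).toAffine.negY x y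
    · rw [WeierstrassCurve.Affine.Point.add_self_of_Y_eq hy]
      exact dvd_zero _
    · rw [WeierstrassCurve.Affine.Point.add_self_of_Y_ne hy]
      have heq := (equation_iff x y).1 h.1
      obtain ⟨he, hx, hyy⟩ := some_eq x y h
      have hc := coprime_M (WeierstrassCurve.Affine.Point.some x y h : RatPoint a b c)
      have hns := WeierstrassCurve.Affine.nonsingular_add h h fun hxy => hy hxy.right
      obtain ⟨he', hx', -⟩ := some_eq _ _ hns
      have hsl := (curve (a : ℚ) (b : ℚ) (c : ℚ)).toAffine.slope_of_Y_ne (rfl : x = x) hy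
      have hy0 : y ≠ 0 := by
        rintro rfl
        exact hy (by simp [curve, WeierstrassCurve.Affine.negY])
      have hdup : (curve (a : ℚ) (b : ℚ) (c : ℚ)).toAffine.addX x x
          ((curve (a : ℚ) (b : ℚ) (c : ℚ)).toAffine.slope x x y y) * (4 * y ^ 2) =
          x ^ 4 - 2 * b * x ^ 2 - 8 * c * x + b ^ 2 - 4 * a * c := by
        have hs : (curve (a : ℚ) (b : ℚ) (c : ℚ)).toAffine.slope x x y y =
            (3 * x ^ 2 + 2 * a * x + b) / (2 * y) := by
          rw [hsl]
          simp only [curve, WeierstrassCurve.Affine.negY]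
          congr 1 <;> ring
        rw [hs]
        simp only [curve, WeierstrassCurve.Affine.addX]
        field_simp
        linear_combination (-16 * a - 32 * x) * heq
      change coordE _ ∣ coordE (WeierstrassCurve.Affine.Point.some _ _ hns : RatPoint a b c)
      rw [hx'] at hdup
      clear hx'
      generalize coordE (WeierstrassCurve.Affine.Point.some _ _ hns : RatPoint a b c) = e' at *
      generalize coordM (WeierstrassCurve.Affine.Point.some _ _ hns : RatPoint a b c) = m' at *
      generalize coordE (WeierstrassCurve.Affine.Point.some x y h : RatPoint a b c) = e at *
      generalize coordM (WeierstrassCurve.Affine.Point.some x y h : RatPoint a b c) = m at *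
      generalize coordN (WeierstrassCurve.Affine.Point.some x y h : RatPoint a b c) = n at *
      have h0 : (e : ℚ) ≠ 0 := by exact_mod_cast he.ne'
      have h0' : (e' : ℚ) ≠ 0 := by exact_mod_cast he'.ne'
      rw [hx, hyy] at hdup
      field_simp at hdup
      have h1 : (m' : ℚ) * (4 * n ^ 2) * e ^ 2 = e' ^ 2 *
          (m ^ 4 + e * (e ^ 3 * (-2 * b * m ^ 2 - 8 * c * m * e ^ 2
            + (b ^ 2 - 4 * a * c) * e ^ 4))) := by
        linear_combination hdup
      have h2 : m' * (4 * n ^ 2) * (e : ℤ) ^ 2 = (e' : ℤ) ^ 2 *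
          (m ^ 4 + e * (e ^ 3 * (-2 * b * m ^ 2 - 8 * c * m * e ^ 2
            + (b ^ 2 - 4 * a * c) * e ^ 4))) := by exact_mod_cast h1
      have hcop := (((hc.pow_left (m := 4)).add_mul_left_left
        ((e : ℤ) ^ 3 * (-2 * b * m ^ 2 - 8 * c * m * e ^ 2
            + (b ^ 2 - 4 * a * c) * e ^ 4))).symm).pow_left (m := 2)
      have h3 : (e : ℤ) ^ 2 ∣ (e' : ℤ) ^ 2 :=
        hcop.dvd_of_dvd_mul_right ⟨m' * (4 * n ^ 2), by rw [← h2]; ring⟩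
      have h4 : e ^ 2 ∣ e' ^ 2 := by exact_mod_cast h3
      exact (Nat.pow_dvd_pow_iff two_ne_zero).1 h4

/-- `F₀ = e₀` and `F_k = e_k / e_{k-1}` for `k ≥ 1`, where `e_k` belongs to `2 ^ k P`. -/
def fermat (P : RatPoint a b c) : ℕ → ℕ
  | 0 => coordE P
  | k + 1 => coordE (2 ^ (k + 1) • P) / coordE (2 ^ k • P)

/-- The division in the definition of `fermat` is exact. -/
theorem fermat_succ_mul (P : RatPoint a b c) (k : ℕ) :
    fermat P (k + 1) * coordE (2 ^ k • P) = coordE (2 ^ (k + 1) • P) := by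
  refine Nat.div_mul_cancel ?_
  rw [pow_succ', mul_smul]
  exact coordE_dvd_two_nsmul _

end LowestTerms

/-! ### The points of the curve over a ring and their sum -/

section Ring

variable {R : Type*} [CommRing R]

/-- A triple is primitive if its entries generate the unit ideal. -/
def IsPrimitive (v : Fin 3 → R) : Prop := ∃ w : Fin 3 → R, ∑ i, w i * v i = 1

/-- Primitive solutions `(x, y, z)` of `y² z = x³ + a x² z + b x z² + c z³`. -/
structure Rep (a b c : R) where
  coord : Fin 3 → R
  equation : (curve a b c).toProjective.Equation coord
  primitive : IsPrimitive coord

/-- Two representatives are equivalent if they differ by a unit of `R`. -/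
instance repSetoid (a b c : R) : Setoid (Rep a b c) where
  r s t := ∃ u : Rˣ, t.coord = u • s.coord
  iseqv :=
    { refl := fun s => ⟨1, by simp⟩
      symm := fun {s t} ⟨u, hu⟩ => ⟨u⁻¹, by rw [hu, inv_smul_smul]⟩
      trans := fun {s t r} ⟨u, hu⟩ ⟨v, hv⟩ => ⟨v * u, by rw [hv, hu, mul_smul]⟩ }

/-- The set `E(R)` of points `(x : y : z)` with primitive coordinates on
`y² z = x³ + a x² z + b x z² + c z³`. -/
def Point (a b c : R) : Type _ := Quotient (repSetoid a b c)

/-- The point `(0 : 1 : 0)`. -/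
instance (a b c : R) : Zero (Point a b c) where
  zero := Quotient.mk _
    { coord := ![0, 1, 0]
      equation := by
        rw [WeierstrassCurve.Projective.equation_iff]
        simp
      primitive := ⟨![0, 1, 0], by simp [Fin.sum_univ_three]⟩ }

/-- The three addition laws of bidegree `(2, 2)` on `y² z = x³ + a x² z + b x z² + c z³`. Each row,
evaluated at representatives of `S` and `T`, is proportional to the coordinates of `S + T`. Over a
field, for a nonsingular curve, the first, second and third row vanish exactly when `S - T` lies on
the line `z = 0`, `y = 0`, `x = 0` respectively, so they never vanish simultaneously. -/
def additionLaws (a b c : R) (s t : Fin 3 → R) : Matrix (Fin 3) (Fin 3) R :=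
  let x₁ := s 0
  let y₁ := s 1
  let z₁ := s 2
  let x₂ := t 0
  let y₂ := t 1
  let z₂ := t 2
  !![2 * y₁ * z₁ * x₂ * y₂ + y₁ ^ 2 * x₂ * z₂ + 3 * c * x₁ * z₁ * z₂ ^ 2 + b * x₁ ^ 2 * z₂ ^ 2
       + a * x₁ ^ 2 * x₂ * z₂ - x₁ * z₁ * y₂ ^ 2 - 2 * x₁ * y₁ * y₂ * z₂
       - 3 * c * z₁ ^ 2 * x₂ * z₂ - b * z₁ ^ 2 * x₂ ^ 2 - a * x₁ * z₁ * x₂ ^ 2,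
     y₁ ^ 2 * y₂ * z₂ + 3 * x₁ ^ 2 * x₂ * y₂ + 3 * c * z₁ ^ 2 * y₂ * z₂ + b * z₁ ^ 2 * x₂ * y₂
       + 2 * b * x₁ * z₁ * y₂ * z₂ + 2 * a * x₁ * z₁ * x₂ * y₂ + a * x₁ ^ 2 * y₂ * z₂
       - y₁ * z₁ * y₂ ^ 2 - 3 * x₁ * y₁ * x₂ ^ 2 - 3 * c * y₁ * z₁ * z₂ ^ 2
       - 2 * b * y₁ * z₁ * x₂ * z₂ - b * x₁ * y₁ * z₂ ^ 2 - a * y₁ * z₁ * x₂ ^ 2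
       - 2 * a * x₁ * y₁ * x₂ * z₂,
     y₁ ^ 2 * z₂ ^ 2 + 3 * x₁ * z₁ * x₂ ^ 2 + b * z₁ ^ 2 * x₂ * z₂ + a * z₁ ^ 2 * x₂ ^ 2
       - z₁ ^ 2 * y₂ ^ 2 - 3 * x₁ ^ 2 * x₂ * z₂ - b * x₁ * z₁ * z₂ ^ 2 - a * x₁ ^ 2 * z₂ ^ 2;
     y₁ ^ 2 * x₂ * y₂ + x₁ * y₁ * y₂ ^ 2 + b ^ 2 * z₁ ^ 2 * y₂ * z₂ + b ^ 2 * y₁ * z₁ * z₂ ^ 2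
       - 3 * c * z₁ ^ 2 * x₂ * y₂ - 6 * c * y₁ * z₁ * x₂ * z₂ - 6 * c * x₁ * z₁ * y₂ * z₂
       - 3 * c * x₁ * y₁ * z₂ ^ 2 - b * y₁ * z₁ * x₂ ^ 2 - 2 * b * x₁ * z₁ * x₂ * y₂
       - 2 * b * x₁ * y₁ * x₂ * z₂ - b * x₁ ^ 2 * y₂ * z₂ - a * x₁ * y₁ * x₂ ^ 2
       - a * x₁ ^ 2 * x₂ * y₂ - 4 * a * c * z₁ ^ 2 * y₂ * z₂ - 4 * a * c * y₁ * z₁ * z₂ ^ 2,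
     y₁ ^ 2 * y₂ ^ 2 + 9 * c * x₁ * z₁ * x₂ ^ 2 + 9 * c * x₁ ^ 2 * x₂ * z₂
       + 3 * b * x₁ ^ 2 * x₂ ^ 2 + 3 * a * c * z₁ ^ 2 * x₂ ^ 2 + 12 * a * c * x₁ * z₁ * x₂ * z₂
       + 3 * a * c * x₁ ^ 2 * z₂ ^ 2 + 4 * a * b * c * z₁ ^ 2 * z₂ ^ 2
       + 4 * a ^ 2 * c * z₁ ^ 2 * x₂ * z₂ + 4 * a ^ 2 * c * x₁ * z₁ * z₂ ^ 2
       - 9 * c ^ 2 * z₁ ^ 2 * z₂ ^ 2 - 3 * b * c * z₁ ^ 2 * x₂ * z₂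
       - 3 * b * c * x₁ * z₁ * z₂ ^ 2 - b ^ 2 * z₁ ^ 2 * x₂ ^ 2 - 4 * b ^ 2 * x₁ * z₁ * x₂ * z₂
       - b ^ 2 * x₁ ^ 2 * z₂ ^ 2 - a * b * x₁ * z₁ * x₂ ^ 2 - a * b * x₁ ^ 2 * x₂ * z₂
       - a ^ 2 * x₁ ^ 2 * x₂ ^ 2 - b ^ 3 * z₁ ^ 2 * z₂ ^ 2 - a * b ^ 2 * z₁ ^ 2 * x₂ * z₂
       - a * b ^ 2 * x₁ * z₁ * z₂ ^ 2,
     y₁ * z₁ * y₂ ^ 2 + y₁ ^ 2 * y₂ * z₂ + 3 * x₁ * y₁ * x₂ ^ 2 + 3 * x₁ ^ 2 * x₂ * y₂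
       + 3 * c * z₁ ^ 2 * y₂ * z₂ + 3 * c * y₁ * z₁ * z₂ ^ 2 + b * z₁ ^ 2 * x₂ * y₂
       + 2 * b * y₁ * z₁ * x₂ * z₂ + 2 * b * x₁ * z₁ * y₂ * z₂ + b * x₁ * y₁ * z₂ ^ 2
       + a * y₁ * z₁ * x₂ ^ 2 + 2 * a * x₁ * z₁ * x₂ * y₂ + 2 * a * x₁ * y₁ * x₂ * z₂
       + a * x₁ ^ 2 * y₂ * z₂;
     y₁ ^ 2 * x₂ ^ 2 + 3 * c * z₁ ^ 2 * x₂ ^ 2 + b * x₁ * z₁ * x₂ ^ 2 + b ^ 2 * x₁ * z₁ * z₂ ^ 2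
       + 4 * a * c * z₁ ^ 2 * x₂ * z₂ - x₁ ^ 2 * y₂ ^ 2 - 3 * c * x₁ ^ 2 * z₂ ^ 2
       - b * x₁ ^ 2 * x₂ * z₂ - b ^ 2 * z₁ ^ 2 * x₂ * z₂ - 4 * a * c * x₁ * z₁ * z₂ ^ 2,
     y₁ ^ 2 * x₂ * y₂ + 6 * c * y₁ * z₁ * x₂ * z₂ + 3 * c * x₁ * y₁ * z₂ ^ 2
       + b * y₁ * z₁ * x₂ ^ 2 + 2 * b * x₁ * y₁ * x₂ * z₂ + a * x₁ * y₁ * x₂ ^ 2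
       + b ^ 2 * z₁ ^ 2 * y₂ * z₂ + 4 * a * c * y₁ * z₁ * z₂ ^ 2 - x₁ * y₁ * y₂ ^ 2
       - 3 * c * z₁ ^ 2 * x₂ * y₂ - 6 * c * x₁ * z₁ * y₂ * z₂ - 2 * b * x₁ * z₁ * x₂ * y₂
       - b * x₁ ^ 2 * y₂ * z₂ - a * x₁ ^ 2 * x₂ * y₂ - b ^ 2 * y₁ * z₁ * z₂ ^ 2
       - 4 * a * c * z₁ ^ 2 * y₂ * z₂,
     y₁ ^ 2 * x₂ * z₂ + 2 * x₁ * y₁ * y₂ * z₂ + 3 * c * x₁ * z₁ * z₂ ^ 2 + b * x₁ ^ 2 * z₂ ^ 2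
       + a * x₁ ^ 2 * x₂ * z₂ - 2 * y₁ * z₁ * x₂ * y₂ - x₁ * z₁ * y₂ ^ 2
       - 3 * c * z₁ ^ 2 * x₂ * z₂ - b * z₁ ^ 2 * x₂ ^ 2 - a * x₁ * z₁ * x₂ ^ 2]

/-- `U = S + T` if some representative of `U` is a linear combination of the rows of the matrix of
addition laws at representatives of `S` and `T`. -/
def IsSum {a b c : R} (S T U : Point a b c) : Prop :=
  ∃ s t u : Rep a b c, S = Quotient.mk _ s ∧ T = Quotient.mk _ t ∧ U = Quotient.mk _ u ∧
    ∃ l : Fin 3 → R, u.coord = Matrix.vecMul l (additionLaws a b c s.coord t.coord)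

open Classical in
/-- The sum of two points of `E(R)`. If `R` is finite and the discriminant is invertible, exactly
one point satisfies `IsSum S T`; the default value `0` serves other rings only. -/
noncomputable instance (a b c : R) : Add (Point a b c) where
  add S T := if h : ∃ U, IsSum S T U then h.choose else 0

/-- `S` has order `n`: `n` is the least positive integer with `n S = S + ⋯ + S = 0`. -/
def HasOrder {a b c : R} (S : Point a b c) (n : ℕ) : Prop :=
  IsLeast {m : ℕ | 0 < m ∧ nsmulRec m S = 0} n

end Ring

/-- Reduction modulo `N`: `P = (me : n : e³) ↦ (me mod N : n mod N : e³ mod N)`. -/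
def reduce (N : ℕ) {a b c : ℤ} (P : RatPoint a b c) :
    Point (a : ZMod N) (b : ZMod N) (c : ZMod N) :=
  Quotient.mk _
    { coord := ![((coordM P * coordE P : ℤ) : ZMod N), ((coordN P : ℤ) : ZMod N),
        (((coordE P : ℤ) ^ 3 : ℤ) : ZMod N)]
      equation := by
        have h := congrArg (fun z : ℤ => (z : ZMod N)) (coord_equation P)
        push_cast at h
        rw [WeierstrassCurve.Projective.equation_iff]
        simp [curve]
        linear_combination (coordE P : ZMod N) ^ 3 * h
      primitive := by
        obtain ⟨u, v, h⟩ := (coprime_N P).pow_right (n := 3)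
        have h' := congrArg (fun z : ℤ => (z : ZMod N)) h
        push_cast at h'
        refine ⟨![0, u, v], ?_⟩
        simp [Fin.sum_univ_three]
        linear_combination h' }

end EllipticFermat

namespace EllipticFermat

/-! ### General properties of the addition laws -/

section AdditionLaws

variable {R : Type*} [CommRing R]

/-! The theorem rests on reduction E(ℚ) → E(ℤ/N) being additive (`reduce_add`). Over ℚ, the 3×3
matrix of addition laws at P, Q is an outer product: weights times the coordinates of P + Q
(`additionLaws_affineCoord`). In primitive integral coordinates the weights are integers
(`additionLaws_intCoord`). For a prime p dividing N they are not all divisible by p, because modulo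
p the addition laws have no common zero (`exists_additionLaws_ne_zero`). So the weights generate the
unit ideal modulo N, and the primitive combination of the rows is the reduction of P + Q, up to a
unit.

A point reduces to zero exactly when N divides its e (`reduce_eq_zero_iff`), so the integers m with
N ∣ e(mP) form a subgroup of ℤ. Its least positive element is 2 ^ k exactly when it contains 2 ^ k
but no smaller power of 2. As e_k is the telescoping product F₀⋯F_k, these e_k form a divisibility
chain and only the exponent k - 1 has to be tested. -/

theorem projective_equation_iff (a b c : R) (v : Fin 3 → R) :
    (curve a b c).toProjective.Equation v ↔
      v 1 ^ 2 * v 2 = v 0 ^ 3 + a * v 0 ^ 2 * v 2 + b * v 0 * v 2 ^ 2 + c * v 2 ^ 3 := by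
  rw [WeierstrassCurve.Projective.equation_iff, ← sub_eq_zero (a := v 1 ^ 2 * v 2)]
  simp [curve]

theorem additionLaws_map {S : Type*} [CommRing S] (f : R →+* S) (a b c : R) (s t : Fin 3 → R)
    (i j : Fin 3) :
    additionLaws (f a) (f b) (f c) (fun k => f (s k)) (fun k => f (t k)) i j =
      f (additionLaws a b c s t i j) := by
  fin_cases i <;> fin_cases j <;> simp [additionLaws, map_ofNat]

theorem additionLaws_smul (a b c α β : R) (s t : Fin 3 → R) (i j : Fin 3) :
    additionLaws a b c (α • s) (β • t) i j = α ^ 2 * β ^ 2 * additionLaws a b c s t i j := by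
  fin_cases i <;> fin_cases j <;> simp [additionLaws] <;> ring

/-- The point of `E(R)` with a given representative. -/
def Point.mk {a b c : R} (s : Rep a b c) : Point a b c := Quotient.mk _ s

/-- If the matrix of addition laws at `s`, `t` is an outer product with last factor `u`, then every
sum of the classes of `s` and `t` is the class of `u`. -/
theorem IsSum.eq_of_outer {a b c : R} {s t u : Rep a b c} {w : Fin 3 → R}
    (h : ∀ i j, additionLaws a b c s.coord t.coord i j = w i * u.coord j) {U : Point a b c}
    (hU : IsSum (Point.mk s) (Point.mk t) U) : U = Point.mk u := by
  obtain ⟨s', t', u', hs, ht, rfl, l, hl⟩ := hU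
  obtain ⟨α, hα⟩ := Quotient.exact hs
  obtain ⟨β, hβ⟩ := Quotient.exact ht
  have hκ : ∀ j, u'.coord j = (α ^ 2 * β ^ 2 * ∑ i, l i * w i : R) * u.coord j := by
    intro j
    have hs' : s'.coord = (α : R) • s.coord := hα
    have ht' : t'.coord = (β : R) • t.coord := hβ
    rw [hl, Matrix.vecMul, dotProduct, hs', ht', Finset.mul_sum, Finset.sum_mul]
    refine Finset.sum_congr rfl fun i _ => ?_
    rw [additionLaws_smul, h]
    ring
  obtain ⟨v, hv⟩ := u'.primitive
  -- Since `u'` is primitive, the factor relating it to `u` must be a unit.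
  have hunit : (α ^ 2 * β ^ 2 * ∑ i, l i * w i : R) * ∑ j, v j * u.coord j = 1 := by
    rw [← hv, Finset.mul_sum]
    refine Finset.sum_congr rfl fun j _ => ?_
    rw [hκ]
    ring
  have hrel : (repSetoid a b c).r u u' := ⟨Units.mkOfMulEqOne _ _ hunit, funext hκ⟩
  exact (Quotient.sound hrel).symm

/-- The weights `l` exhibit one sum, so addition does not take its default value;
`IsSum.eq_of_outer` shows that the chosen sum can be no other. -/
theorem add_eq_of_outer {a b c : R} {s t u : Rep a b c} {w l : Fin 3 → R}
    (h : ∀ i j, additionLaws a b c s.coord t.coord i j = w i * u.coord j)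
    (hl : ∑ i, l i * w i = 1) :
    Point.mk s + Point.mk t = Point.mk u := by
  have hex : ∃ U : Point a b c, IsSum (Point.mk s) (Point.mk t) U := by
    refine ⟨Point.mk u, s, t, u, rfl, rfl, rfl, l, funext fun j => ?_⟩
    rw [Matrix.vecMul, dotProduct]
    simp only [h, ← mul_assoc]
    rw [← Finset.sum_mul, hl, one_mul]
  have hadd : Point.mk s + Point.mk t = hex.choose := dif_pos hex
  rw [hadd]
  exact hex.choose_spec.eq_of_outer h

end AdditionLaws

/-- Over a field in which `2 Δ` is invertible the addition laws have no common zero. -/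
theorem exists_additionLaws_ne_zero {F : Type*} [Field F] {a b c : F} (h2 : (2 : F) ≠ 0)
    (hΔ : (curve a b c).Δ ≠ 0) {s t : Fin 3 → F}
    (hs : (curve a b c).toProjective.Equation s) (ht : (curve a b c).toProjective.Equation t)
    (hs0 : s ≠ 0) (ht0 : t ≠ 0) : ∃ i j, additionLaws a b c s t i j ≠ 0 := by
  by_contra! H
  rw [projective_equation_iff] at hs ht
  have h8 : (8 : F) ≠ 0 := by
    have : (8 : F) = 2 ^ 3 := by norm_num
    rw [this]; exact pow_ne_zero _ h2
  -- These five of the nine entries already force a contradiction.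
  have H02 := H 0 2
  have H01 := H 0 1
  have H11 := H 1 1
  have H12 := H 1 2
  have H20 := H 2 0
  clear H
  simp only [additionLaws, Matrix.of_apply, Matrix.cons_val, Matrix.cons_val_zero,
    Matrix.cons_val_one] at H01 H02 H11 H12 H20
  have ext0 : ∀ v : Fin 3 → F, v 0 = 0 → v 1 = 0 → v 2 = 0 → v = 0 := by
    intro v h0 h1 h2
    funext i
    fin_cases i <;> assumption
  have hs0' := mt (fun h : s 0 = 0 ∧ s 1 = 0 ∧ s 2 = 0 => ext0 s h.1 h.2.1 h.2.2) hs0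
  have ht0' := mt (fun h : t 0 = 0 ∧ t 1 = 0 ∧ t 2 = 0 => ext0 t h.1 h.2.1 h.2.2) ht0
  generalize s 0 = x₁ at *
  generalize s 1 = y₁ at *
  generalize s 2 = z₁ at *
  generalize t 0 = x₂ at *
  generalize t 1 = y₂ at *
  generalize t 2 = z₂ at *
  by_cases hz₁ : z₁ = 0
  · subst hz₁
    obtain rfl : x₁ = 0 := by simpa using hs.symm
    have hy : y₁ ≠ 0 := by simpa using hs0'
    refine ht0' ⟨?_, ?_, ?_⟩
    · simpa [hy] using H20
    · simpa [hy] using H11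
    · simpa [hy] using H02
  by_cases hz₂ : z₂ = 0
  · subst hz₂
    obtain rfl : x₂ = 0 := by simpa using ht.symm
    have hy : y₂ ≠ 0 := by simpa using ht0'
    exact hz₁ (by simpa [hy] using H02)
  obtain ⟨x₁, rfl⟩ : ∃ x, x₁ = z₁ * x := ⟨x₁ / z₁, by field_simp⟩
  obtain ⟨y₁, rfl⟩ : ∃ y, y₁ = z₁ * y := ⟨y₁ / z₁, by field_simp⟩
  obtain ⟨x₂, rfl⟩ : ∃ x, x₂ = z₂ * x := ⟨x₂ / z₂, by field_simp⟩
  obtain ⟨y₂, rfl⟩ : ∃ y, y₂ = z₂ * y := ⟨y₂ / z₂, by field_simp⟩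
  have hz : z₁ ^ 2 * z₂ ^ 2 ≠ 0 := mul_ne_zero (pow_ne_zero _ hz₁) (pow_ne_zero _ hz₂)
  have hs1 : y₁ ^ 2 = x₁ ^ 3 + a * x₁ ^ 2 + b * x₁ + c :=
    mul_left_cancel₀ (pow_ne_zero 3 hz₁) (by linear_combination hs)
  have ht1 : y₂ ^ 2 = x₂ ^ 3 + a * x₂ ^ 2 + b * x₂ + c :=
    mul_left_cancel₀ (pow_ne_zero 3 hz₂) (by linear_combination ht)
  -- In affine coordinates on the curve, entry (0, 2) is (x₁ - x₂)³.
  have hx : x₁ = x₂ := by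
    have : z₁ ^ 2 * z₂ ^ 2 * (x₁ - x₂) ^ 3 = 0 := by
      linear_combination H02 - z₁ ^ 2 * z₂ ^ 2 * (hs1 - ht1)
    exact sub_eq_zero.1 (by simpa [hz₁, hz₂] using this)
  subst hx
  have hc : c = y₁ ^ 2 - x₁ ^ 3 - a * x₁ ^ 2 - b * x₁ := by linear_combination -hs1
  subst hc
  have hy : y₁ = y₂ := by
    rcases sq_eq_sq_iff_eq_or_eq_neg.1 (hs1.trans ht1.symm) with h | h
    · exact h
    · subst h
      -- For opposite points, entry (0, 1) is 8y³ up to sign.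
      have : z₁ ^ 2 * z₂ ^ 2 * (8 * y₂ ^ 3) = 0 := by linear_combination H01
      have : y₂ = 0 := by simpa [hz₁, hz₂, h8] using this
      simp [this]
  subst hy
  have hy0 : y₁ = 0 := by
    have : z₁ ^ 2 * z₂ ^ 2 * (8 * y₁ ^ 3) = 0 := by linear_combination H12
    simpa [hz₁, hz₂, h8] using this
  subst hy0
  -- At a 2-torsion point, entry (1, 1) is minus the cube of the derivative of the cubic at x₁. Its
  -- vanishing makes x₁ a double root, so Δ = 0.
  have hd : 3 * x₁ ^ 2 + 2 * a * x₁ + b = 0 := by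
    have : z₁ ^ 2 * z₂ ^ 2 * (3 * x₁ ^ 2 + 2 * a * x₁ + b) ^ 3 = 0 := by
      linear_combination -H11
    simpa [hz₁, hz₂] using this
  have hb : b = -(3 * x₁ ^ 2 + 2 * a * x₁) := by linear_combination hd
  subst hb
  refine hΔ ?_
  rw [curve_disc]
  ring

/-! ### The addition laws and the group law over `ℚ` -/

section Rational

variable {a b c : ℤ}

/-- The coordinates of a rational point, with last coordinate `1` at affine points. -/
def affineCoord : RatPoint a b c → Fin 3 → ℚ
  | .zero => ![0, 1, 0]
  | .some x y _ => ![x, y, 1]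

/-- The addition laws on two points of a non-vertical line `y = l x + m`. -/
theorem additionLaws_line {F : Type*} [Field F] {a b c l x₁ x₂ y₁ y₂ x₃ y₃ : F}
    (h₁ : y₁ ^ 2 = x₁ ^ 3 + a * x₁ ^ 2 + b * x₁ + c) (hy : y₁ - y₂ = l * (x₁ - x₂))
    (hl : l * (y₁ + y₂) = x₁ ^ 2 + x₁ * x₂ + x₂ ^ 2 + a * (x₁ + x₂) + b)
    (hx₃ : x₃ = l ^ 2 - a - x₁ - x₂) (hy₃ : y₃ = -(l * (x₃ - x₁) + y₁)) (i j : Fin 3) :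
    additionLaws a b c ![x₁, y₁, 1] ![x₂, y₂, 1] i j =
      additionLaws a b c ![x₁, y₁, 1] ![x₂, y₂, 1] i 2 * (![x₃, y₃, 1] : Fin 3 → F) j := by
  -- The relation `hl` holds for chords and tangents alike. Solving for y₂, b and c leaves
  -- polynomial identities in free variables.
  obtain rfl : y₂ = y₁ - l * (x₁ - x₂) := by linear_combination -hy
  obtain rfl : b = l * (y₁ + (y₁ - l * (x₁ - x₂))) -
      (x₁ ^ 2 + x₁ * x₂ + x₂ ^ 2 + a * (x₁ + x₂)) := by linear_combination -hl
  obtain rfl := eq_sub_of_add_eq' h₁.symm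
  subst hx₃ hy₃
  fin_cases i <;> fin_cases j <;>
    simp only [additionLaws, Matrix.of_apply, Matrix.cons_val, Matrix.cons_val_zero,
      Matrix.cons_val_one, Fin.zero_eta, Fin.mk_one, Fin.reduceFinMk] <;> ring

/-- The addition laws on two points of a vertical line. -/
theorem additionLaws_vertical {F : Type*} [Field F] {a b c x y : F}
    (h : y ^ 2 = x ^ 3 + a * x ^ 2 + b * x + c) (i j : Fin 3) :
    additionLaws a b c ![x, -y, 1] ![x, y, 1] i j =
      additionLaws a b c ![x, -y, 1] ![x, y, 1] i 1 * (![0, 1, 0] : Fin 3 → F) j := by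
  obtain rfl := eq_sub_of_add_eq' h.symm
  fin_cases i <;> fin_cases j <;>
    simp only [additionLaws, Matrix.of_apply, Matrix.cons_val, Matrix.cons_val_zero,
      Matrix.cons_val_one, Fin.zero_eta, Fin.mk_one, Fin.reduceFinMk] <;> ring

/-- The cases are those of the chord-and-tangent law: a summand at infinity, a vertical line, any
other line. At affine sums the weights are the z-column, at infinity the y-column, where the sum has
coordinate 1. -/
theorem additionLaws_affineCoord (P Q : RatPoint a b c) : ∃ w : Fin 3 → ℚ, ∀ i j,
    additionLaws (a : ℚ) b c (affineCoord P) (affineCoord Q) i j =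
      w i * affineCoord (P + Q) j := by
  rcases P with _ | ⟨x₁, y₁, h₁⟩
  · have : (WeierstrassCurve.Affine.Point.zero + Q : RatPoint a b c) = Q := zero_add Q
    rw [this]
    rcases Q with _ | ⟨x₂, y₂, h₂⟩
    · refine ⟨![0, 1, 0], fun i j => ?_⟩
      fin_cases i <;> fin_cases j <;> simp [additionLaws, affineCoord]
    · refine ⟨![1, y₂, x₂], fun i j => ?_⟩
      fin_cases i <;> fin_cases j <;> simp [additionLaws, affineCoord] <;> ring
  rcases Q with _ | ⟨x₂, y₂, h₂⟩
  · have : (WeierstrassCurve.Affine.Point.some x₁ y₁ h₁ + WeierstrassCurve.Affine.Point.zero :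
        RatPoint a b c) = .some x₁ y₁ h₁ := add_zero (M := RatPoint a b c) _
    rw [this]
    refine ⟨![-1, y₁, -x₁], fun i j => ?_⟩
    fin_cases i <;> fin_cases j <;> simp [additionLaws, affineCoord] <;> ring
  have e₁ := (equation_iff x₁ y₁).1 h₁.1
  have e₂ := (equation_iff x₂ y₂).1 h₂.1
  have hneg : (curve (a : ℚ) b c).toAffine.negY x₂ y₂ = -y₂ := by
    simp [curve, WeierstrassCurve.Affine.negY]
  by_cases hxy : x₁ = x₂ ∧ y₁ = (curve (a : ℚ) b c).toAffine.negY x₂ y₂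
  · rw [WeierstrassCurve.Affine.Point.add_of_Y_eq hxy.1 hxy.2]
    obtain ⟨rfl, hy⟩ := hxy
    obtain rfl := hy.trans hneg
    rw [neg_sq] at e₁
    exact ⟨_, additionLaws_vertical e₁⟩
  · rw [WeierstrassCurve.Affine.Point.add_some hxy]
    refine ⟨fun i => additionLaws (a : ℚ) b c ![x₁, y₁, 1] ![x₂, y₂, 1] i 2, fun i j =>
      additionLaws_line (l := (curve (a : ℚ) b c).toAffine.slope x₁ x₂ y₁ y₂) e₁ ?_ ?_ ?_ ?_ i j⟩
    -- Equal abscissas on a non-vertical line mean equal points, the tangent case.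
    · by_cases hx : x₁ = x₂
      · subst hx
        have : y₁ = y₂ := by
          rcases sq_eq_sq_iff_eq_or_eq_neg.1 (e₁.trans e₂.symm) with h | h
          · exact h
          · exact absurd ⟨rfl, h.trans hneg.symm⟩ hxy
        simp [this]
      · rw [WeierstrassCurve.Affine.slope_of_X_ne hx, div_mul_cancel₀ _ (sub_ne_zero.2 hx)]
    · by_cases hx : x₁ = x₂
      · subst hx
        have hy : y₁ ≠ (curve (a : ℚ) b c).toAffine.negY x₁ y₂ := fun h => hxy ⟨rfl, h⟩
        have : y₁ = y₂ := by
          rcases sq_eq_sq_iff_eq_or_eq_neg.1 (e₁.trans e₂.symm) with h | h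
          · exact h
          · exact absurd (h.trans hneg.symm) hy
        subst this
        have hy0 : y₁ ≠ 0 := by
          rintro rfl
          exact hy (by rw [hneg, neg_zero])
        rw [WeierstrassCurve.Affine.slope_of_Y_ne rfl hy, hneg]
        simp only [curve]
        field_simp
        ring
      · rw [WeierstrassCurve.Affine.slope_of_X_ne hx]
        have := sub_ne_zero.2 hx
        field_simp
        linear_combination e₁ - e₂
    · simp only [WeierstrassCurve.Affine.addX, curve]
      ring
    · simp only [WeierstrassCurve.Affine.addY, WeierstrassCurve.Affine.negAddY,
        WeierstrassCurve.Affine.negY, curve]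
      ring

end Rational


/-! ### Integral coordinates and additivity of reduction modulo N -/

section Reduction

variable {a b c : ℤ}

/-- The primitive integral coordinates `(m e, n, e³)` of a rational point. -/
def intCoord (P : RatPoint a b c) : Fin 3 → ℤ :=
  ![coordM P * coordE P, coordN P, (coordE P : ℤ) ^ 3]

theorem intCoord_equation (P : RatPoint a b c) :
    (curve a b c).toProjective.Equation (intCoord P) := by
  rw [projective_equation_iff]
  simp only [intCoord, Matrix.cons_val]
  linear_combination (coordE P : ℤ) ^ 3 * coord_equation P

theorem intCoord_primitive (P : RatPoint a b c) : IsPrimitive (intCoord P) := by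
  obtain ⟨u, v, h⟩ := (coprime_N P).pow_right (n := 3)
  refine ⟨![0, u, v], ?_⟩
  simp [Fin.sum_univ_three, intCoord]
  linear_combination h

theorem intCoord_eq_smul (P : RatPoint a b c) :
    ∃ r : ℚ, r ≠ 0 ∧ (fun i => (intCoord P i : ℚ)) = r • affineCoord P := by
  rcases P with _ | ⟨x, y, h⟩
  · refine ⟨1, one_ne_zero, funext fun i => ?_⟩
    fin_cases i <;> simp [intCoord, affineCoord, coordE, coordM, coordN]
  · obtain ⟨he, hx, hy⟩ := some_eq x y h
    generalize hP : (WeierstrassCurve.Affine.Point.some x y h : RatPoint a b c) = P at *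
    have he' : (coordE P : ℚ) ≠ 0 := by exact_mod_cast he.ne'
    have hA : affineCoord P = ![x, y, 1] := by rw [← hP]; rfl
    refine ⟨(coordE P : ℚ) ^ 3, pow_ne_zero _ he', funext fun i => ?_⟩
    rw [hA, hx, hy]
    fin_cases i <;> simp [intCoord] <;> field_simp

/-- On primitive integral coordinates the addition laws are integral multiples of the
coordinates of the sum. -/
theorem additionLaws_intCoord (P Q : RatPoint a b c) : ∃ w : Fin 3 → ℤ, ∀ i j,
    additionLaws a b c (intCoord P) (intCoord Q) i j = w i * intCoord (P + Q) j := by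
  obtain ⟨w, hw⟩ := additionLaws_affineCoord P Q
  obtain ⟨p, -, hp⟩ := intCoord_eq_smul P
  obtain ⟨q, -, hq⟩ := intCoord_eq_smul Q
  obtain ⟨r, -, hr⟩ := intCoord_eq_smul (P + Q)
  have hr' : ∀ j, (intCoord (P + Q) j : ℚ) = r * affineCoord (P + Q) j := fun j => congrFun hr j
  have key : ∀ i j, ((additionLaws a b c (intCoord P) (intCoord Q) i j : ℤ) : ℚ) =
      p ^ 2 * q ^ 2 * (w i * affineCoord (P + Q) j) := by
    intro i j
    have := additionLaws_map (Int.castRingHom ℚ) a b c (intCoord P) (intCoord Q) i j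
    simp only [eq_intCast] at this
    rw [← this, hp, hq, additionLaws_smul, hw]
  -- Each row is proportional over ℚ to the coordinates of P + Q, so the 2×2 minors vanish.
  -- Contracting them with Bézout coefficients `v` of those coordinates gives integral weights.
  have cross : ∀ i j k, additionLaws a b c (intCoord P) (intCoord Q) i j * intCoord (P + Q) k =
      additionLaws a b c (intCoord P) (intCoord Q) i k * intCoord (P + Q) j := by
    intro i j k
    have : ((additionLaws a b c (intCoord P) (intCoord Q) i j : ℤ) : ℚ) * intCoord (P + Q) k =
        (additionLaws a b c (intCoord P) (intCoord Q) i k : ℤ) * intCoord (P + Q) j := by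
      rw [key, key, hr', hr']
      ring
    exact_mod_cast this
  obtain ⟨v, hv⟩ := intCoord_primitive (P + Q)
  refine ⟨fun i => ∑ k, additionLaws a b c (intCoord P) (intCoord Q) i k * v k, fun i j => ?_⟩
  rw [← mul_one (additionLaws a b c _ _ i j), ← hv, Finset.mul_sum, Finset.sum_mul]
  refine Finset.sum_congr rfl fun k _ => ?_
  linear_combination v k * cross i j k

theorem ne_zero_of_isPrimitive {F : Type*} [Field F] {v : Fin 3 → F} (h : IsPrimitive v) :
    v ≠ 0 := by
  rintro rfl
  obtain ⟨w, hw⟩ := h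
  simp at hw

variable (N : ℕ)

/-- The reduction modulo `N` of the primitive integral coordinates. -/
def reduceRep (P : RatPoint a b c) : Rep (a : ZMod N) (b : ZMod N) (c : ZMod N) where
  coord i := (intCoord P i : ZMod N)
  equation := by
    have h := congrArg (Int.cast : ℤ → ZMod N)
      ((projective_equation_iff a b c _).1 (intCoord_equation P))
    rw [projective_equation_iff]
    exact_mod_cast h
  primitive := by
    obtain ⟨w, hw⟩ := intCoord_primitive P
    refine ⟨fun i => (w i : ZMod N), ?_⟩
    have h := congrArg (Int.cast : ℤ → ZMod N) hw
    push_cast at h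
    exact h

theorem reduce_eq_mk (P : RatPoint a b c) : reduce N P = Point.mk (reduceRep N P) := by
  refine congrArg (Quotient.mk _) ?_
  simp only [reduceRep, Rep.mk.injEq]
  funext i
  fin_cases i <;> simp [intCoord]

theorem additionLaws_reduceRep {P Q : RatPoint a b c} {w : Fin 3 → ℤ} (hw : ∀ i j,
    additionLaws a b c (intCoord P) (intCoord Q) i j = w i * intCoord (P + Q) j) (i j : Fin 3) :
    additionLaws (a : ZMod N) b c (reduceRep N P).coord (reduceRep N Q).coord i j =
      (w i : ZMod N) * (reduceRep N (P + Q)).coord j := by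
  have h := additionLaws_map (Int.castRingHom (ZMod N)) a b c (intCoord P) (intCoord Q) i j
  simp only [eq_intCast, hw] at h
  simp only [reduceRep]
  rw [h]
  push_cast
  rfl

variable {N}

theorem curve_disc_cast {R : Type*} [CommRing R] (a b c : ℤ) :
    (curve (a : R) (b : R) (c : R)).Δ = ((curve a b c).Δ : R) := by
  rw [curve_disc, curve_disc]
  push_cast
  ring

/-- If p divided every weight, the whole matrix would vanish modulo p, although 2 and Δ are
invertible there. -/
theorem exists_not_dvd_of_prime {p : ℕ} (hp : p.Prime)
    (hgcd : IsCoprime (p : ℤ) (6 * (curve a b c).Δ)) {P Q : RatPoint a b c} {w : Fin 3 → ℤ}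
    (hw : ∀ i j, additionLaws a b c (intCoord P) (intCoord Q) i j =
      w i * intCoord (P + Q) j) : ∃ i, ¬ (p : ℤ) ∣ w i := by
  have := Fact.mk hp
  have cast_ne_zero : ∀ m : ℤ, m ∣ 6 * (curve a b c).Δ → (m : ZMod p) ≠ 0 := by
    intro m hm h
    rw [ZMod.intCast_zmod_eq_zero_iff_dvd] at h
    exact (Nat.prime_iff_prime_int.1 hp).not_isUnit
      (hgcd.isUnit_of_dvd' dvd_rfl (h.trans hm))
  have h2 : (2 : ZMod p) ≠ 0 := by
    exact_mod_cast cast_ne_zero 2 ((by norm_num : (2 : ℤ) ∣ 6).mul_right _)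
  have hΔ : (curve (a : ZMod p) (b : ZMod p) (c : ZMod p)).Δ ≠ 0 := by
    rw [curve_disc_cast]
    exact cast_ne_zero _ (dvd_mul_left _ _)
  obtain ⟨i, j, hij⟩ := exists_additionLaws_ne_zero h2 hΔ (reduceRep p P).equation
    (reduceRep p Q).equation (ne_zero_of_isPrimitive (reduceRep p P).primitive)
    (ne_zero_of_isPrimitive (reduceRep p Q).primitive)
  refine ⟨i, fun h => hij ?_⟩
  rw [additionLaws_reduceRep p hw, (ZMod.intCast_zmod_eq_zero_iff_dvd _ _).2 h, zero_mul]

/-- The gcd of the weights is coprime to N, so Bézout, used for this gcd and then for its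
coprimality to N, gives `l`. -/
theorem exists_sum_mul_eq_one_of_forall_prime {w : Fin 3 → ℤ}
    (h : ∀ p : ℕ, p.Prime → p ∣ N → ∃ i, ¬ (p : ℤ) ∣ w i) :
    ∃ l : Fin 3 → ZMod N, ∑ i, l i * (w i : ZMod N) = 1 := by
  have hcop : IsCoprime (N : ℤ) (Finset.univ.gcd w) := by
    rw [Int.isCoprime_iff_gcd_eq_one]
    by_contra hne
    obtain ⟨p, hp, hpd⟩ := Nat.exists_prime_and_dvd hne
    have hpd' : (p : ℤ) ∣ (Int.gcd (N : ℤ) (Finset.univ.gcd w) : ℤ) := by exact_mod_cast hpd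
    obtain ⟨i, hi⟩ := h p hp (by exact_mod_cast hpd'.trans (Int.gcd_dvd_left ..))
    exact hi ((hpd'.trans (Int.gcd_dvd_right ..)).trans (Finset.gcd_dvd (Finset.mem_univ i)))
  obtain ⟨u, v, huv⟩ := hcop
  obtain ⟨l, hl⟩ := Finset.gcd_eq_sum_mul Finset.univ w
  refine ⟨fun i => (v * l i : ℤ), ?_⟩
  have h1 : ∑ i, v * l i * w i = 1 - u * N := by
    rw [← huv, hl, Finset.mul_sum, add_sub_cancel_left]
    exact Finset.sum_congr rfl fun i _ => by ring
  have h2 := congrArg (Int.cast : ℤ → ZMod N) h1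
  push_cast at h2 ⊢
  rw [h2, ZMod.natCast_self, mul_zero, sub_zero]

theorem reduce_add (hgcd : IsCoprime (N : ℤ) (6 * (curve a b c).Δ))
    (P Q : RatPoint a b c) : reduce N P + reduce N Q = reduce N (P + Q) := by
  obtain ⟨w, hw⟩ := additionLaws_intCoord P Q
  obtain ⟨l, hl⟩ := exists_sum_mul_eq_one_of_forall_prime (w := w) fun p hp hpN =>
    exists_not_dvd_of_prime hp (hgcd.of_isCoprime_of_dvd_left (by exact_mod_cast hpN)) hw
  simp only [reduce_eq_mk]
  exact add_eq_of_outer (additionLaws_reduceRep N hw) hl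

theorem reduce_eq_zero_iff (P : RatPoint a b c) : reduce N P = 0 ↔ N ∣ coordE P := by
  have hcop := coprime_M P
  rw [← Int.natCast_dvd_natCast, ← ZMod.intCast_zmod_eq_zero_iff_dvd]
  constructor
  · intro h
    obtain ⟨u, hu⟩ := Quotient.exact h
    have h0 := congrFun hu 0
    have h2 := congrFun hu 2
    simp only [Pi.smul_apply, Matrix.cons_val] at h0 h2
    have hM : (coordM P : ZMod N) * coordE P = 0 := by simpa [Units.smul_def] using h0.symm
    have hE : (coordE P : ZMod N) ^ 3 = 0 := by simpa [Units.smul_def] using h2.symm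
    -- Multiplying this Bézout relation by e writes e as a combination of me and e³, both zero
    -- modulo N.
    obtain ⟨m, n, hmn⟩ := hcop.pow_right (n := 2)
    have h3 := congrArg (Int.cast : ℤ → ZMod N) hmn
    push_cast at h3 ⊢
    linear_combination (-(coordE P : ZMod N)) * h3 + (m : ZMod N) * hM + (n : ZMod N) * hE
  · intro h
    -- Once e vanishes modulo N, the coordinate n is a unit, and it is the scaling factor from (0 :
    -- 1 : 0).
    obtain ⟨m, n, hmn⟩ := coprime_N P
    have hn : (coordN P : ZMod N) * (m : ZMod N) = 1 := by
      have := congrArg (Int.cast : ℤ → ZMod N) hmn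
      push_cast at this h
      rw [h] at this
      linear_combination this
    refine (Quotient.sound (?_ : (repSetoid _ _ _).r _ _)).symm
    refine ⟨Units.mkOfMulEqOne _ _ hn, funext fun i => ?_⟩
    push_cast at h
    fin_cases i <;> simp [h, Units.smul_def]

/-- Only sums of reductions occur, so no group axioms on E(ℤ/N) are needed. -/
theorem nsmulRec_reduce (hgcd : IsCoprime (N : ℤ) (6 * (curve a b c).Δ))
    (P : RatPoint a b c) (m : ℕ) : nsmulRec m (reduce N P) = reduce N (m • P) := by
  induction m with
  | zero =>
    rw [zero_nsmul]
    refine ((reduce_eq_zero_iff (0 : RatPoint a b c)).2 ?_).symm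
    exact dvd_zero N
  | succ m ih =>
    rw [succ_nsmul, ← reduce_add hgcd, ← ih]
    rfl

/-! ### Multiples of P reducing to zero, and orders that are powers of 2 -/

theorem coordE_neg (P : RatPoint a b c) : coordE (-P) = coordE P := by
  rcases P with _ | ⟨x, y, h⟩ <;> rfl

/-- The multiples of `P` that reduce to zero modulo `N`. -/
def kernelMultiples (hgcd : IsCoprime (N : ℤ) (6 * (curve a b c).Δ))
    (P : RatPoint a b c) : AddSubgroup ℤ where
  carrier := {m | N ∣ coordE (m • P)}
  zero_mem' := by
    change N ∣ coordE ((0 : ℤ) • P)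
    rw [zero_zsmul]
    exact dvd_zero N
  add_mem' := by
    intro m n hm hn
    simp only [Set.mem_ofPred_eq, ← reduce_eq_zero_iff] at hm hn ⊢
    rw [add_zsmul, ← reduce_add hgcd, hm, hn]
    -- The identity 0 + 0 = 0 in E(ℤ/N) is inherited from E(ℚ).
    have h0 : reduce N (0 : RatPoint a b c) = 0 := (reduce_eq_zero_iff _).2 (dvd_zero N)
    have := reduce_add hgcd (0 : RatPoint a b c) 0
    rwa [add_zero, h0] at this
  neg_mem' := by
    intro m hm
    simp only [Set.mem_ofPred_eq] at hm ⊢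
    rwa [neg_zsmul, coordE_neg]

/-- A positive m < 2 ^ k in H would put gcd(m, 2 ^ k) in H. This gcd is a power of 2 and at most m,
hence a smaller power 2 ^ j. -/
theorem isLeast_pos_mem_two_pow_iff (H : AddSubgroup ℤ) (k : ℕ) :
    IsLeast {m : ℕ | 0 < m ∧ (m : ℤ) ∈ H} (2 ^ k) ↔
      ((2 ^ k : ℕ) : ℤ) ∈ H ∧ ∀ j < k, ((2 ^ j : ℕ) : ℤ) ∉ H := by
  constructor
  · rintro ⟨⟨-, hk⟩, hmin⟩
    refine ⟨hk, fun j hj h => ?_⟩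
    exact (Nat.pow_lt_pow_right one_lt_two hj).not_ge (hmin ⟨by positivity, h⟩)
  · rintro ⟨hk, hmin⟩
    refine ⟨⟨by positivity, hk⟩, fun m ⟨hm, hmH⟩ => ?_⟩
    by_contra! hlt
    obtain ⟨j, hjk, hj⟩ := (Nat.dvd_prime_pow Nat.prime_two).1 (Nat.gcd_dvd_right m (2 ^ k))
    have hmem : ((Nat.gcd m (2 ^ k) : ℕ) : ℤ) ∈ H := by
      rw [Nat.gcd_eq_gcd_ab]
      refine H.add_mem ?_ ?_
      · rw [mul_comm, ← smul_eq_mul]; exact H.zsmul_mem hmH _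
      · rw [mul_comm, ← smul_eq_mul]; exact H.zsmul_mem hk _
    rw [hj] at hmem
    rcases hjk.lt_or_eq with h | rfl
    · exact hmin j h hmem
    · exact ((Nat.gcd_le_left _ hm).trans_lt hlt).ne hj

theorem prod_fermat (P : RatPoint a b c) (k : ℕ) :
    ∏ i ∈ Finset.range (k + 1), fermat P i = coordE (2 ^ k • P) := by
  induction k with
  | zero => simp [fermat]
  | succ k ih => rw [Finset.prod_range_succ, ih, mul_comm, fermat_succ_mul]

end Reduction

end EllipticFermat

open EllipticFermat in
theorem mainTheorem2 (a b c : ℤ) (hΔ : (curve a b c).Δ ≠ 0)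
    (P : RatPoint a b c) (hP : ¬ IsOfFinAddOrder P)
    (N : ℕ) (hN : 0 < N) (hgcd : IsCoprime (N : ℤ) (6 * (curve a b c).Δ))
    (k : ℕ) (hNk : N ≠ 1 ∨ k ≠ 0) :
    ∏ i ∈ Finset.range (k + 1), fermat P i = coordE (2 ^ k • P) ∧
      (HasOrder (reduce N P) (2 ^ k) ↔
        N ∣ ∏ i ∈ Finset.range (k + 1), fermat P i ∧
          ¬ N ∣ ∏ i ∈ Finset.range k, fermat P i) := by
  refine ⟨prod_fermat P k, ?_⟩
  have hmem : ∀ m : ℕ, nsmulRec m (reduce N P) = 0 ↔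
      (m : ℤ) ∈ kernelMultiples hgcd P := by
    intro m
    rw [nsmulRec_reduce hgcd, reduce_eq_zero_iff, ← natCast_zsmul]
    rfl
  have hmem' : ∀ m : ℕ, (m : ℤ) ∈ kernelMultiples hgcd P ↔ N ∣ coordE (m • P) := by
    intro m
    rw [← natCast_zsmul]
    rfl
  simp only [HasOrder, hmem]
  rw [isLeast_pos_mem_two_pow_iff, hmem', ← prod_fermat]
  refine and_congr_right fun _ => ?_
  simp only [hmem', ← prod_fermat]
  -- For k = 0 the condition on smaller exponents is vacuous, and N ∤ 1 because (N, k) ≠ (1, 0). For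
  -- a positive exponent, the shorter products divide the longest one, so that one decides.
  rcases k with _ | k
  · simpa using hNk
  · refine ⟨fun h => h k k.lt_succ_self, fun h j hj hd => h (hd.trans ?_)⟩
    exact Finset.prod_dvd_prod_of_subset _ _ _ (Finset.range_subset_range.2 hj)
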